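/- Let $n\ge 0$ and let $\sigma=\sum_{i=1}^{r'}\omega_i(\mathbf y)\,e_{\xi_i}(\mathbf y)\in\mathbb C[[y_1,\dots,y_n]]$, where $\omega_i\in\mathbb C[\mathbf y]$, $\xi_i\in\mathbb C^n$ and $e_{\xi}(\mathbf y)=\sum_{\alpha\in\mathbb N^n}\xi^\alpha\frac{\mathbf y^\alpha}{\alpha!}$. Write $\sigma=\sum_\alpha\sigma_\alpha\frac{\mathbf y^\alpha}{\alpha!}$ and, for $p=\sum_\alpha p_\alpha\mathbf x^\alpha\in\mathbb C[\mathbf x]$, $\langle\sigma\mid p\rangle=\sum_\alpha p_\alpha\sigma_\alpha$; let $p\star\sigma$ be the series defined by $\langle p\star\sigma\mid q\rangle=\langle\sigma\mid pq\rangle$ for all $q\in\mathbb C[\mathbf x]$. Let $I_\sigma=\{p\in\mathbb C[\mathbf x]\mid \langle\sigma\mid pq\rangle=0 \text{ for all } q\in\mathbb C[\mathbf x]\}$ and $\mathcal A_\sigma=\mathbb C[\mathbf x]/I_\sigma$. For $d_1,d_2\in\mathbb N$ let $H_\sigma^{d_1,d_2}=[\sigma_{\alpha+\beta}]_{|\alpha|\le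 d_1,\,|\beta|\le d_2}$, a matrix of size $N_1\times N_2$. For a polynomial $\omega$ let $\mu(\omega)$ be the dimension of the vector space spanned by $\omega$ and all its partial derivatives of any order. Suppose that $\sum_{i=1}^{r'}\mu(\omega_i)=r$ and $\operatorname{rank}H_\sigma^{d_1,d_2}=r$. Let $H_\sigma^{d_1,d_2}=U S V^{\mathsf T}$ be any singular value decomposition, i.e. $U\in\mathbb C^{N_1\times N_1}$ and $V\in\mathbb C^{N_2\times N_2}$ are unitary and $S\in\mathbb R^{N_1\times N_2}$ is diagonal with nonnegative diagonal entries in decreasing order. Let $U_r^{\mathsf H}$ be the $r\times N_1$ matrix formed by the first $r$ rows of the hermitian transpose $U^{\mathsf H}$ of $U$, let $\overline V_r$ be the $N_2\times r$ matrix formed by the first $r$ columns of the complex conjugate $\overline V$ of $V$, and let $S_r$ be the submatrix of the first $r$ rows and columns of $S$. Put, for $1\le i,j\le r$, $$u_i(\mathbf x)=\sum_{|\alpha|\le d_1}(U_r^{\mathsf H})_{i,\alpha}\,\mathbf x^\alpha,\qquad v_j(\mathbf x)=\sum_{|\beta|\le d_2}(\overline V_r)_{\beta,j}\,\mathbf x^\beta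 .$$ Then the classes of $u_1,\dots,u_r$ form a basis of $\mathcal A_\sigma$ over $\mathbb C$, and so do the classes of $v_1,\dots,v_r$. Moreover $S_r$ is invertible and, for $i=1,\dots,n$, the matrix of multiplication by $x_i$ on $\mathcal A_\sigma$ in the basis $(v_1,\dots,v_r)$ is $$M_{x_i}^{\overline V_r}=S_r^{-1}\,U_r^{\mathsf H}\,H_{x_i\star\sigma}^{d_1,d_2}\,\overline V_r .$$ -/

import Mathlib

open scoped Matrix Nat

noncomputable section

namespace MultiHankel

variable {n : ℕ}

/-- The multi-index factorial `α! = α₁! ⋯ αₙ!`, as a complex number. -/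
def multiFactorial (α : Fin n →₀ ℕ) : ℂ := ∏ i, ((α i)! : ℂ)

/-- The moments of a series: `σ = ∑ σ_α y^α / α!`, so `σ_α` is `α!` times the coefficient of
`y^α`. -/
def moment (σ : MvPowerSeries (Fin n) ℂ) (α : Fin n →₀ ℕ) : ℂ :=
  multiFactorial α * MvPowerSeries.coeff α σ

/-- The linear functional `p = ∑ p_α x^α ↦ ⟨σ | p⟩ = ∑ p_α σ_α` associated to a series. -/
def pairing (σ : MvPowerSeries (Fin n) ℂ) : MvPolynomial (Fin n) ℂ →ₗ[ℂ] ℂ :=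
  (MvPolynomial.basisMonomials (Fin n) ℂ).constr ℂ (moment σ)

/-- The series `p ⋆ σ`, whose moments are `⟨p ⋆ σ | x^α⟩ = ⟨σ | p x^α⟩`. -/
def star (p : MvPolynomial (Fin n) ℂ) (σ : MvPowerSeries (Fin n) ℂ) :
    MvPowerSeries (Fin n) ℂ :=
  fun α => pairing σ (p * MvPolynomial.monomial α 1) / multiFactorial α

/-- The exponential series `e_ξ(y) = ∑ ξ^α y^α / α!`. -/
def expSeries (ξ : Fin n → ℂ) : MvPowerSeries (Fin n) ℂ :=
  fun α => (∏ i, ξ i ^ α i) / multiFactorial α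

/-- The polynomial-exponential series `∑ ωᵢ(y) e_{ξᵢ}(y)`. -/
def polyExp {r' : ℕ} (ω : Fin r' → MvPolynomial (Fin n) ℂ) (ξ : Fin r' → Fin n → ℂ) :
    MvPowerSeries (Fin n) ℂ :=
  ∑ i, (ω i : MvPowerSeries (Fin n) ℂ) * expSeries (ξ i)

/-- The differential operator `∂^α = ∂₁^α₁ ⋯ ∂ₙ^αₙ` on polynomials. -/
def partialDeriv (α : Fin n →₀ ℕ) : Module.End ℂ (MvPolynomial (Fin n) ℂ) :=
  (List.ofFn fun i : Fin n =>
    ((MvPolynomial.pderiv i).toLinearMap : Module.End ℂ (MvPolynomial (Fin n) ℂ)) ^ α i).prod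

/-- `μ(ω)`: the dimension of the space spanned by `ω` and all its derivatives `∂^α ω`. -/
def mu (ω : MvPolynomial (Fin n) ℂ) : ℕ :=
  Module.finrank ℂ (Submodule.span ℂ (Set.range fun α : Fin n →₀ ℕ => partialDeriv α ω))

/-- The ideal `I_σ = {p | ∀ q, ⟨σ | p q⟩ = 0}`, the kernel of the Hankel operator of `σ`. -/
def kernelIdeal (σ : MvPowerSeries (Fin n) ℂ) : Ideal (MvPolynomial (Fin n) ℂ) where
  carrier := {p | ∀ q, pairing σ (p * q) = 0}
  add_mem' := by
    intro a b ha hb q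
    rw [add_mul, map_add, ha q, hb q, add_zero]
  zero_mem' := by
    intro q
    rw [zero_mul, map_zero]
  smul_mem' := by
    intro c p hp q
    have h := hp (c * q)
    rwa [mul_left_comm, ← mul_assoc] at h

/-- The quotient algebra `A_σ = ℂ[x] / I_σ`. -/
abbrev QuotAlg (σ : MvPowerSeries (Fin n) ℂ) : Type :=
  MvPolynomial (Fin n) ℂ ⧸ kernelIdeal σ

/-- The class in `A_σ` of a polynomial. -/
abbrev toQuot (σ : MvPowerSeries (Fin n) ℂ) (p : MvPolynomial (Fin n) ℂ) : QuotAlg σ :=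
  Ideal.Quotient.mk (kernelIdeal σ) p

/-- The multiplication operator `M_g : h ↦ g h` of `A_σ`. -/
def mulOp (σ : MvPowerSeries (Fin n) ℂ) (g : MvPolynomial (Fin n) ℂ) :
    QuotAlg σ →ₗ[ℂ] QuotAlg σ :=
  LinearMap.mulLeft ℂ (toQuot σ g)

/-- The exponents of the monomials in `n` variables of degree at most `d`. -/
abbrev Mon (n d : ℕ) : Type := {α : Fin n →₀ ℕ // α.degree ≤ d}

instance instFintypeMon (n d : ℕ) : Fintype (Mon n d) :=
  (Finsupp.finite_of_degree_le (σ := Fin n) d).fintype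

/-- The truncated Hankel matrix `H_σ^{d₁,d₂} = [σ_{α+β}]`, `|α| ≤ d₁`, `|β| ≤ d₂`. -/
def hankel (σ : MvPowerSeries (Fin n) ℂ) (d₁ d₂ : ℕ) : Matrix (Mon n d₁) (Mon n d₂) ℂ :=
  Matrix.of fun α β => moment σ (α.1 + β.1)

/-- The polynomial with the given coefficients on the monomials of degree at most `d`. -/
def toPoly {d : ℕ} (c : Mon n d → ℂ) : MvPolynomial (Fin n) ℂ :=
  ∑ α : Mon n d, MvPolynomial.monomial α.1 (c α)

/-- `H = U S Vᵀ` is a singular value decomposition: `U` and `V` are (square) unitary matrices and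
`S` is a rectangular diagonal matrix, with nonnegative real diagonal entries in decreasing
order. -/
structure IsSVD {k l : Type} [Fintype k] [Fintype l] [DecidableEq k] [DecidableEq l]
    (H : Matrix k l ℂ)
    (U : Matrix k (Fin (Fintype.card k)) ℂ)
    (S : Matrix (Fin (Fintype.card k)) (Fin (Fintype.card l)) ℂ)
    (V : Matrix l (Fin (Fintype.card l)) ℂ) : Prop where
  unitary_U : Uᴴ * U = 1 ∧ U * Uᴴ = 1
  unitary_V : Vᴴ * V = 1 ∧ V * Vᴴ = 1
  diagonal_S : ∃ s : ℕ → ℝ, Antitone s ∧ (∀ i, 0 ≤ s i) ∧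
    ∀ i j, S i j = if (i : ℕ) = (j : ℕ) then (s i : ℂ) else 0
  factorization : H = U * S * Vᵀ

/-- The first `r` columns of a matrix. -/
def firstCols {k : Type} {N r : ℕ} (h : r ≤ N) (M : Matrix k (Fin N) ℂ) :
    Matrix k (Fin r) ℂ :=
  M.submatrix id (Fin.castLE h)

/-- The submatrix of the first `r` rows and columns of a matrix. -/
def leadingBlock {N₁ N₂ r : ℕ} (h₁ : r ≤ N₁) (h₂ : r ≤ N₂) (M : Matrix (Fin N₁) (Fin N₂) ℂ) :
    Matrix (Fin r) (Fin r) ℂ :=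
  M.submatrix (Fin.castLE h₁) (Fin.castLE h₂)

theorem le_card_rows {k l : Type} [Fintype k] [Fintype l] {H : Matrix k l ℂ} {r : ℕ}
    (h : H.rank = r) : r ≤ Fintype.card k :=
  h ▸ H.rank_le_card_height

theorem le_card_cols {k l : Type} [Fintype k] [Fintype l] {H : Matrix k l ℂ} {r : ℕ}
    (h : H.rank = r) : r ≤ Fintype.card l :=
  h ▸ H.rank_le_card_width

end MultiHankel

end

open scoped Matrix Nat

noncomputable section

namespace MultiHankel

variable {n : ℕ}

/-! The SVD gives `Ur * H * Vr = Sr`, and rank r makes `Sr` invertible. The entries of this product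
are the pairings ⟨σ | u_i v_j⟩, so both families are independent modulo I_σ
(`linearIndependent_toQuot`). They span because dim A_σ ≤ r. Indeed A_σ is isomorphic to the space
of all p ⋆ σ; the variable x_i acts on series as ∂_i, and ∂_i (w e_ξ) = (∂_i w + ξ_i w) e_ξ. So
every p ⋆ σ has the form ∑ w_i e_{ξ_i} with w_i in the span of the derivatives of ω_i, which gives
dim A_σ ≤ ∑ μ(ω_i) = r (`finrank_quotAlg_polyExp_le`). Pairing the expansion of x_i v_j in the basis
(v_m) with each u_l yields S_r M = U_rᴴ H_{x_i ⋆ σ} V̄_r (`toMatrix_mulOp_eq`). -/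

theorem multiFactorial_ne_zero (α : Fin n →₀ ℕ) : multiFactorial α ≠ 0 :=
  Finset.prod_ne_zero_iff.2 fun _ _ => Nat.cast_ne_zero.2 (Nat.factorial_ne_zero _)

theorem multiFactorial_add_single (α : Fin n →₀ ℕ) (i : Fin n) :
    multiFactorial (α + Finsupp.single i 1) = (α i + 1) * multiFactorial α := by
  classical
  unfold multiFactorial
  rw [← Finset.mul_prod_erase _ _ (Finset.mem_univ i),
    ← Finset.mul_prod_erase _ (fun j => ((α j)! : ℂ)) (Finset.mem_univ i), ← mul_assoc]
  congr 1
  · simp [Nat.factorial_succ]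
  · refine Finset.prod_congr rfl fun j hj => ?_
    simp [Finsupp.single_eq_of_ne (Finset.ne_of_mem_erase hj)]

theorem pairing_monomial (σ : MvPowerSeries (Fin n) ℂ) (α : Fin n →₀ ℕ) (c : ℂ) :
    pairing σ (MvPolynomial.monomial α c) = c * moment σ α := by
  have h : MvPolynomial.monomial α c = c • MvPolynomial.basisMonomials (Fin n) ℂ α := by
    simp [MvPolynomial.smul_monomial]
  rw [h, map_smul, pairing, Module.Basis.constr_basis, smul_eq_mul]

theorem moment_star (p : MvPolynomial (Fin n) ℂ) (σ : MvPowerSeries (Fin n) ℂ)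
    (α : Fin n →₀ ℕ) :
    moment (star p σ) α = pairing σ (p * MvPolynomial.monomial α 1) :=
  mul_div_cancel₀ _ (multiFactorial_ne_zero α)

theorem pairing_star (p q : MvPolynomial (Fin n) ℂ) (σ : MvPowerSeries (Fin n) ℂ) :
    pairing (star p σ) q = pairing σ (p * q) := by
  suffices h : pairing (star p σ) = pairing σ ∘ₗ LinearMap.mulLeft ℂ p from
    LinearMap.congr_fun h q
  refine (MvPolynomial.basisMonomials (Fin n) ℂ).ext fun α => ?_
  simp [pairing_monomial, moment_star]

theorem moment_injective : Function.Injective (moment (n := n)) := by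
  intro σ τ h
  ext α
  exact mul_left_cancel₀ (multiFactorial_ne_zero α) (congrFun h α)

theorem star_mul (p q : MvPolynomial (Fin n) ℂ) (σ : MvPowerSeries (Fin n) ℂ) :
    star (p * q) σ = star p (star q σ) := by
  refine moment_injective (funext fun α => ?_)
  rw [moment_star, moment_star, pairing_star, mul_left_comm, mul_assoc]

/-- The map `p ↦ p ⋆ σ`, as a linear map. -/
def hankelOp (σ : MvPowerSeries (Fin n) ℂ) :
    MvPolynomial (Fin n) ℂ →ₗ[ℂ] MvPowerSeries (Fin n) ℂ where
  toFun p := star p σ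
  map_add' p q := by
    refine moment_injective (funext fun α => ?_)
    have h : ∀ τ τ' : MvPowerSeries (Fin n) ℂ, moment (τ + τ') α = moment τ α + moment τ' α :=
      fun τ τ' => by simp [moment, mul_add]
    simp only [h, moment_star, add_mul, map_add]
  map_smul' c p := by
    refine moment_injective (funext fun α => ?_)
    have h : ∀ τ : MvPowerSeries (Fin n) ℂ, moment (c • τ) α = c * moment τ α :=
      fun τ => by simp [moment, mul_left_comm]
    simp only [h, moment_star, smul_mul_assoc, map_smul, smul_eq_mul, RingHom.id_apply]

theorem hankelOp_apply (σ : MvPowerSeries (Fin n) ℂ) (p : MvPolynomial (Fin n) ℂ) :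
    hankelOp σ p = star p σ := rfl

theorem mem_kernelIdeal {σ : MvPowerSeries (Fin n) ℂ} {p : MvPolynomial (Fin n) ℂ} :
    p ∈ kernelIdeal σ ↔ ∀ q, pairing σ (p * q) = 0 := Iff.rfl

theorem ker_hankelOp (σ : MvPowerSeries (Fin n) ℂ) :
    LinearMap.ker (hankelOp σ) = (kernelIdeal σ).restrictScalars ℂ := by
  ext p
  rw [LinearMap.mem_ker, Submodule.restrictScalars_mem, mem_kernelIdeal, hankelOp_apply]
  constructor
  · intro h q
    rw [← pairing_star, h]
    have h0 : pairing (0 : MvPowerSeries (Fin n) ℂ) = 0 :=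
      (MvPolynomial.basisMonomials (Fin n) ℂ).ext fun α => by simp [pairing_monomial, moment]
    rw [h0, LinearMap.zero_apply]
  · intro h
    refine moment_injective (funext fun α => ?_)
    rw [moment_star, h]
    simp [moment]

/-- `A_σ` is isomorphic to the space of the series `p ⋆ σ`. -/
def quotAlgEquiv (σ : MvPowerSeries (Fin n) ℂ) :
    QuotAlg σ ≃ₗ[ℂ] LinearMap.range (hankelOp σ) :=
  ((Submodule.Quotient.restrictScalarsEquiv ℂ (kernelIdeal σ)).symm.trans
    (Submodule.quotEquivOfEq _ _ (ker_hankelOp σ).symm)).trans (hankelOp σ).quotKerEquivRange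

/-- The factor α_i + 1 produced by differentiation is absorbed by the factorial, so on moments ∂_i
is a pure shift. -/
theorem moment_pderiv (i : Fin n) (σ : MvPowerSeries (Fin n) ℂ) (α : Fin n →₀ ℕ) :
    moment (MvPowerSeries.pderiv ℂ i σ) α = moment σ (α + Finsupp.single i 1) := by
  rw [moment, moment, multiFactorial_add_single, MvPowerSeries.coeff_pderiv]
  ring

theorem star_X (i : Fin n) (σ : MvPowerSeries (Fin n) ℂ) :
    star (MvPolynomial.X i) σ = MvPowerSeries.pderiv ℂ i σ := by
  refine moment_injective (funext fun α => ?_)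
  rw [moment_star, MvPolynomial.X, MvPolynomial.monomial_mul, add_comm, pairing_monomial,
    moment_pderiv, one_mul, one_mul]

theorem moment_expSeries (ξ : Fin n → ℂ) (α : Fin n →₀ ℕ) :
    moment (expSeries ξ) α = ∏ i, ξ i ^ α i :=
  mul_div_cancel₀ _ (multiFactorial_ne_zero α)

theorem pderiv_expSeries (i : Fin n) (ξ : Fin n → ℂ) :
    MvPowerSeries.pderiv ℂ i (expSeries ξ) = ξ i • expSeries ξ := by
  classical
  refine moment_injective (funext fun α => ?_)
  have h : moment (ξ i • expSeries ξ) α = ξ i * moment (expSeries ξ) α := by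
    rw [moment, moment, MvPowerSeries.coeff_smul, mul_left_comm]
  rw [h, moment_pderiv, moment_expSeries, moment_expSeries]
  simp only [Finsupp.add_apply, pow_add, Finset.prod_mul_distrib, Finsupp.single_apply,
    pow_ite, pow_one, pow_zero, Finset.prod_ite_eq, Finset.mem_univ, if_true]
  exact mul_comm _ _

theorem pderiv_mul_expSeries (i : Fin n) (ξ : Fin n → ℂ) (w : MvPolynomial (Fin n) ℂ) :
    MvPowerSeries.pderiv ℂ i ((w : MvPowerSeries (Fin n) ℂ) * expSeries ξ) =
      ((MvPolynomial.pderiv i w + ξ i • w : MvPolynomial (Fin n) ℂ) :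
        MvPowerSeries (Fin n) ℂ) * expSeries ξ := by
  rw [Derivation.leibniz, pderiv_expSeries, MvPowerSeries.pderiv_coe, MvPolynomial.coe_add,
    MvPolynomial.coe_smul]
  simp only [smul_eq_mul, add_mul, smul_mul_assoc, mul_smul_comm]
  ring

/-! ### Spaces of derivatives of a polynomial -/

theorem pderiv_commute (i j : Fin n) :
    Commute ((MvPolynomial.pderiv i).toLinearMap : Module.End ℂ (MvPolynomial (Fin n) ℂ))
      (MvPolynomial.pderiv j).toLinearMap := by
  have h : ⁅MvPolynomial.pderiv (R := ℂ) i, MvPolynomial.pderiv (R := ℂ) j⁆ = 0 := by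
    refine MvPolynomial.derivation_ext fun k => ?_
    classical
    simp [Derivation.commutator_apply, MvPolynomial.pderiv_X, Pi.single_apply, apply_ite]
  refine LinearMap.ext fun p => ?_
  have hp := DFunLike.congr_fun h p
  rw [Derivation.commutator_apply, Derivation.zero_apply, sub_eq_zero] at hp
  exact hp

/-- Commutation carries `f i` past the earlier factors of the ordered product to its own power. -/
theorem _root_.List.mul_prod_ofFn_pow {M : Type*} [Monoid M] {n : ℕ} (f : Fin n → M)
    (hf : ∀ i j, Commute (f i) (f j)) (a : Fin n → ℕ) (i : Fin n) :
    f i * (List.ofFn fun j => f j ^ a j).prod =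
      (List.ofFn fun j => f j ^ (a + Pi.single i 1 : Fin n → ℕ) j).prod := by
  induction n with
  | zero => exact i.elim0
  | succ n ih =>
    rw [List.ofFn_succ, List.ofFn_succ, List.prod_cons, List.prod_cons]
    cases i using Fin.cases with
    | zero => simp [← mul_assoc, pow_succ']
    | succ k =>
      have h := ih (fun j => f j.succ) (fun _ _ => hf _ _) (fun j => a j.succ) k
      rw [← mul_assoc, ((hf k.succ 0).pow_right (a 0)).eq, mul_assoc, h]
      simp [Pi.single_apply]

theorem pderiv_partialDeriv (i : Fin n) (α : Fin n →₀ ℕ) (w : MvPolynomial (Fin n) ℂ) :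
    MvPolynomial.pderiv i (partialDeriv α w) =
      partialDeriv (α + Finsupp.single i 1) w := by
  have h := List.mul_prod_ofFn_pow
    (fun i => ((MvPolynomial.pderiv i).toLinearMap : Module.End ℂ (MvPolynomial (Fin n) ℂ)))
    pderiv_commute α i
  rw [← Finsupp.single_eq_pi_single, ← Finsupp.coe_add] at h
  exact LinearMap.congr_fun h w

/-- The space spanned by a polynomial and all its derivatives. -/
def derivSpace (w : MvPolynomial (Fin n) ℂ) : Submodule ℂ (MvPolynomial (Fin n) ℂ) :=
  Submodule.span ℂ (Set.range fun α : Fin n →₀ ℕ => partialDeriv α w)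

theorem self_mem_derivSpace (w : MvPolynomial (Fin n) ℂ) : w ∈ derivSpace w :=
  Submodule.subset_span ⟨0, by simp [partialDeriv]⟩

theorem pderiv_mem_derivSpace {w v : MvPolynomial (Fin n) ℂ} (i : Fin n)
    (hv : v ∈ derivSpace w) : MvPolynomial.pderiv i v ∈ derivSpace w := by
  have h : derivSpace w ≤ (derivSpace w).comap (MvPolynomial.pderiv i).toLinearMap :=
    Submodule.span_le.2 <| by
      rintro _ ⟨α, rfl⟩
      exact Submodule.subset_span ⟨_, (pderiv_partialDeriv i α w).symm⟩
  exact h hv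

theorem totalDegree_pderiv_le (i : Fin n) (p : MvPolynomial (Fin n) ℂ) :
    (MvPolynomial.pderiv i p).totalDegree ≤ p.totalDegree := by
  refine Finset.sup_le fun α hα => ?_
  rw [MvPolynomial.mem_support_iff, MvPolynomial.coeff_pderiv] at hα
  have h := MvPolynomial.le_totalDegree (MvPolynomial.mem_support_iff.2 (left_ne_zero_of_mul hα))
  rw [Finsupp.sum_add_index' (fun _ => rfl) (fun _ _ _ => rfl)] at h
  exact (Nat.le_add_right _ _).trans h

/-- Derivatives do not raise the total degree, so everything stays among the polynomials of degree
at most that of `w`. -/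
instance instFiniteDimensionalDerivSpace (w : MvPolynomial (Fin n) ℂ) :
    FiniteDimensional ℂ (derivSpace w) := by
  set W := MvPolynomial.restrictTotalDegree (Fin n) ℂ w.totalDegree with hW
  have hW' : ∀ i, ∀ v ∈ W, MvPolynomial.pderiv i v ∈ W := by
    intro i v hv
    rw [hW, MvPolynomial.mem_restrictTotalDegree] at hv ⊢
    exact (totalDegree_pderiv_le i v).trans hv
  refine Submodule.finiteDimensional_of_le (S₂ := W) (Submodule.span_le.2 ?_)
  rintro _ ⟨α, rfl⟩
  change partialDeriv α w ∈ W
  refine List.prod_induction (fun f : Module.End ℂ (MvPolynomial (Fin n) ℂ) => ∀ v ∈ W, f v ∈ W)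
    (fun f g hf hg v hv => hf _ (hg v hv)) (fun v hv => hv) ?_ w
    ((MvPolynomial.mem_restrictTotalDegree _ _ _).2 le_rfl)
  intro f hf
  obtain ⟨i, rfl⟩ := List.mem_ofFn.1 hf
  exact Submodule.le_comap_pow_of_le_comap W (hW' i) (α i)

/-! ### The bound on the dimension of A_σ -/

/-- The series `∑ wᵢ e_{ξᵢ}` whose weights `wᵢ` are in the spaces spanned by the derivatives of
given polynomials. -/
def polyExpMap {r' : ℕ} (ω : Fin r' → MvPolynomial (Fin n) ℂ) (ξ : Fin r' → Fin n → ℂ) :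
    (∀ i, derivSpace (ω i)) →ₗ[ℂ] MvPowerSeries (Fin n) ℂ where
  toFun w := polyExp (fun i => (w i : MvPolynomial (Fin n) ℂ)) ξ
  map_add' v w := by
    simp [polyExp, add_mul, Finset.sum_add_distrib]
  map_smul' c w := by
    simp [polyExp, Finset.smul_sum, MvPolynomial.coe_smul]

theorem star_mem_range_polyExpMap {r' : ℕ} (ω : Fin r' → MvPolynomial (Fin n) ℂ)
    (ξ : Fin r' → Fin n → ℂ) (p : MvPolynomial (Fin n) ℂ) {τ : MvPowerSeries (Fin n) ℂ}
    (hτ : τ ∈ LinearMap.range (polyExpMap ω ξ)) :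
    star p τ ∈ LinearMap.range (polyExpMap ω ξ) := by
  induction p using MvPolynomial.induction_on generalizing τ with
  | C a =>
    have h : star (MvPolynomial.C a) τ = a • τ := by
      refine moment_injective (funext fun α => ?_)
      rw [moment_star, MvPolynomial.C_mul_monomial, pairing_monomial]
      simp [moment, mul_left_comm]
    rw [h]
    exact Submodule.smul_mem _ _ hτ
  | add p q hp hq =>
    rw [← hankelOp_apply, map_add]
    exact add_mem (hp hτ) (hq hτ)
  | mul_X p i hp =>
    rw [star_mul, star_X]
    refine hp ?_
    obtain ⟨w, rfl⟩ := hτ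
    -- The new weights come from the Leibniz rule, e_ξ being an eigenvector of ∂_i.
    refine ⟨fun j => ⟨MvPolynomial.pderiv i (w j) + ξ j i • (w j : MvPolynomial (Fin n) ℂ),
      add_mem (pderiv_mem_derivSpace i (w j).2) (Submodule.smul_mem _ _ (w j).2)⟩, ?_⟩
    change polyExp _ ξ = MvPowerSeries.pderiv ℂ i (polyExp _ ξ)
    simp only [polyExp, map_sum, pderiv_mul_expSeries]

theorem range_hankelOp_polyExp_le {r' : ℕ} (ω : Fin r' → MvPolynomial (Fin n) ℂ)
    (ξ : Fin r' → Fin n → ℂ) :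
    LinearMap.range (hankelOp (polyExp ω ξ)) ≤ LinearMap.range (polyExpMap ω ξ) := by
  rintro _ ⟨p, rfl⟩
  exact star_mem_range_polyExpMap ω ξ p ⟨fun i => ⟨ω i, self_mem_derivSpace _⟩, rfl⟩

theorem finiteDimensional_quotAlg_polyExp {r' : ℕ} (ω : Fin r' → MvPolynomial (Fin n) ℂ)
    (ξ : Fin r' → Fin n → ℂ) : FiniteDimensional ℂ (QuotAlg (polyExp ω ξ)) :=
  have := Submodule.finiteDimensional_of_le (range_hankelOp_polyExp_le ω ξ)
  (quotAlgEquiv (polyExp ω ξ)).symm.finiteDimensional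

/-- Only an inequality: `polyExpMap` need not be injective, for instance when two ξ_i coincide. -/
theorem finrank_quotAlg_polyExp_le {r' : ℕ} (ω : Fin r' → MvPolynomial (Fin n) ℂ)
    (ξ : Fin r' → Fin n → ℂ) :
    Module.finrank ℂ (QuotAlg (polyExp ω ξ)) ≤ ∑ i, mu (ω i) :=
  calc Module.finrank ℂ (QuotAlg (polyExp ω ξ))
      = Module.finrank ℂ (LinearMap.range (hankelOp (polyExp ω ξ))) :=
        (quotAlgEquiv _).finrank_eq
    _ ≤ Module.finrank ℂ (LinearMap.range (polyExpMap ω ξ)) :=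
        Submodule.finrank_mono (range_hankelOp_polyExp_le ω ξ)
    _ ≤ Module.finrank ℂ (∀ i, derivSpace (ω i)) := LinearMap.finrank_range_le _
    _ = ∑ i, mu (ω i) := Module.finrank_pi_fintype ℂ

theorem pairing_toPoly_mul_toPoly (σ : MvPowerSeries (Fin n) ℂ) {d₁ d₂ : ℕ}
    (a : Mon n d₁ → ℂ) (b : Mon n d₂ → ℂ) :
    pairing σ (toPoly a * toPoly b) = a ⬝ᵥ hankel σ d₁ d₂ *ᵥ b := by
  rw [toPoly, toPoly, Finset.sum_mul_sum]
  simp only [map_sum, MvPolynomial.monomial_mul, pairing_monomial,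
    dotProduct, Matrix.mulVec, hankel, Matrix.of_apply, Finset.mul_sum]
  exact Finset.sum_congr rfl fun _ _ => Finset.sum_congr rfl fun _ _ => by ring

theorem pairing_rows_cols (σ : MvPowerSeries (Fin n) ℂ) {d₁ d₂ r : ℕ}
    (A : Matrix (Fin r) (Mon n d₁) ℂ) (B : Matrix (Mon n d₂) (Fin r) ℂ) (i j : Fin r) :
    pairing σ (toPoly (A i) * toPoly fun β => B β j) = (A * hankel σ d₁ d₂ * B) i j := by
  rw [pairing_toPoly_mul_toPoly, Matrix.mul_assoc]
  rfl

/-! ### Truncation of a singular value decomposition -/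

section SVD

variable {k l : Type} [Fintype k] [Fintype l] [DecidableEq k] [DecidableEq l]
  {H : Matrix k l ℂ} {U : Matrix k (Fin (Fintype.card k)) ℂ}
  {S : Matrix (Fin (Fintype.card k)) (Fin (Fintype.card l)) ℂ}
  {V : Matrix l (Fin (Fintype.card l)) ℂ}

theorem IsSVD.truncation_mul (h : IsSVD H U S V) {r : ℕ} (h₁ : r ≤ Fintype.card k)
    (h₂ : r ≤ Fintype.card l) :
    (firstCols h₁ U)ᴴ * H * (firstCols h₂ V).map (starRingEnd ℂ) = leadingBlock h₁ h₂ S := by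
  -- The factorization uses Vᵀ, not Vᴴ, so its inverse is the conjugate of V.
  have hV : Vᵀ * V.map (starRingEnd ℂ) = 1 := by
    have := congrArg Matrix.transpose h.unitary_V.1
    rwa [Matrix.transpose_mul, Matrix.transpose_one] at this
  have hS : Uᴴ * H * V.map (starRingEnd ℂ) = S := by
    rw [h.factorization, Matrix.mul_assoc, Matrix.mul_assoc, hV, Matrix.mul_one,
      ← Matrix.mul_assoc, h.unitary_U.1, Matrix.one_mul]
  rw [leadingBlock, ← hS]
  rfl

theorem IsSVD.isUnit_leadingBlock (h : IsSVD H U S V) {r : ℕ} (hr : H.rank = r) :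
    IsUnit (leadingBlock (le_card_rows hr) (le_card_cols hr) S) := by
  obtain ⟨s, hs, hs0, hS⟩ := h.diagonal_S
  -- A zero singular value at m < r forces all later ones to vanish; S then factors through its
  -- first m columns, so rank H ≤ m < r.
  have hpos : ∀ m < r, s m ≠ 0 := by
    intro m hm h0
    have hz : ∀ j, m ≤ j → s j = 0 := fun j hj => le_antisymm (h0 ▸ hs hj) (hs0 j)
    have hm₂ : m ≤ Fintype.card l := hm.le.trans (le_card_cols hr)
    have hfac : S = S.submatrix id (Fin.castLE hm₂) *
        (1 : Matrix (Fin (Fintype.card l)) (Fin (Fintype.card l)) ℂ).submatrix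
          (Fin.castLE hm₂) id := by
      ext i j
      rw [Matrix.mul_apply]
      simp only [Matrix.submatrix_apply, id, Matrix.one_apply]
      by_cases hj : (j : ℕ) < m
      · rw [Finset.sum_eq_single ⟨j, hj⟩]
        · simp
        · intro x _ hx
          rw [if_neg, mul_zero]
          rintro rfl
          exact hx rfl
        · simp
      · rw [hS, Finset.sum_eq_zero]
        · split_ifs with hij
          · rw [hij, hz _ (not_lt.1 hj), Complex.ofReal_zero]
          · rfl
        · intro x _
          rw [if_neg, mul_zero]
          rintro rfl
          exact hj x.2
    have hrank : S.rank ≤ m := by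
      rw [hfac]
      refine (Matrix.rank_mul_le_left _ _).trans ?_
      simpa using Matrix.rank_le_card_width (S.submatrix id (Fin.castLE hm₂))
    have hH : H.rank ≤ S.rank := by
      rw [h.factorization]
      exact (Matrix.rank_mul_le_left _ _).trans (Matrix.rank_mul_le_right _ _)
    omega
  have hdiag : leadingBlock (le_card_rows hr) (le_card_cols hr) S =
      Matrix.diagonal fun i : Fin r => (s i : ℂ) := by
    ext i j
    simp [leadingBlock, hS, Matrix.diagonal_apply, Fin.ext_iff]
  rw [hdiag, Matrix.isUnit_iff_isUnit_det, Matrix.det_diagonal, isUnit_iff_ne_zero,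
    Finset.prod_ne_zero_iff]
  exact fun i _ => Complex.ofReal_ne_zero.2 (hpos i i.2)

end SVD

/-! ### Bases and multiplication matrices from pairings -/

theorem toQuot_sum_smul (σ : MvPowerSeries (Fin n) ℂ) {r : ℕ} (c : Fin r → ℂ)
    (p : Fin r → MvPolynomial (Fin n) ℂ) :
    ∑ i, c i • toQuot σ (p i) = toQuot σ (∑ i, c i • p i) := by
  exact (map_sum ((Ideal.Quotient.mkₐ ℂ (kernelIdeal σ)).toLinearMap) _ _).symm

theorem pairing_eq_of_toQuot_eq {σ : MvPowerSeries (Fin n) ℂ} {p q : MvPolynomial (Fin n) ℂ}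
    (h : toQuot σ p = toQuot σ q) (f : MvPolynomial (Fin n) ℂ) :
    pairing σ (p * f) = pairing σ (q * f) := by
  have := mem_kernelIdeal.1 (Ideal.Quotient.eq.1 h) f
  rwa [sub_mul, map_sub, sub_eq_zero] at this

/-- Two families of polynomials with an invertible matrix of pairings have linearly independent
classes in `A_σ`. -/
theorem linearIndependent_toQuot (σ : MvPowerSeries (Fin n) ℂ) {r : ℕ}
    {p q : Fin r → MvPolynomial (Fin n) ℂ}
    (h : IsUnit (Matrix.of fun i j => pairing σ (p i * q j))) :
    LinearIndependent ℂ fun i => toQuot σ (p i) := by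
  refine Fintype.linearIndependent_iff.2 fun c hc => ?_
  rw [toQuot_sum_smul, ← map_zero (Ideal.Quotient.mk (kernelIdeal σ))] at hc
  -- Pairing a linear relation with each q_j puts its coefficients in the left kernel of the pairing
  -- matrix.
  have hv : c ᵥ* (Matrix.of fun i j => pairing σ (p i * q j)) = 0 := by
    ext j
    have := pairing_eq_of_toQuot_eq hc (q j)
    simpa [Finset.sum_mul, Matrix.vecMul, dotProduct] using this
  exact congrFun (Matrix.vecMul_injective_of_isUnit h (hv.trans (Matrix.zero_vecMul _).symm))

/-- If the matrix `[⟨σ | pᵢ qⱼ⟩]` is invertible and the `qⱼ` form a basis of `A_σ`, it determines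
the matrices of multiplication. -/
theorem toMatrix_mulOp_eq (σ : MvPowerSeries (Fin n) ℂ) {r : ℕ}
    {p q : Fin r → MvPolynomial (Fin n) ℂ} {T : Matrix (Fin r) (Fin r) ℂ}
    (hT : IsUnit T) (hpq : ∀ i j, pairing σ (p i * q j) = T i j)
    (B : Module.Basis (Fin r) ℂ (QuotAlg σ)) (hB : ∀ j, B j = toQuot σ (q j))
    (g : MvPolynomial (Fin n) ℂ) :
    LinearMap.toMatrix B B (mulOp σ g) =
      T⁻¹ * Matrix.of fun i j => pairing (star g σ) (p i * q j) := by
  have key : T * LinearMap.toMatrix B B (mulOp σ g) =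
      Matrix.of fun i j => pairing (star g σ) (p i * q j) := by
    ext i j
    have h1 := B.sum_repr (mulOp σ g (B j))
    simp only [hB] at h1
    rw [toQuot_sum_smul] at h1
    have h2 : mulOp σ g (toQuot σ (q j)) = toQuot σ (g * q j) := (map_mul _ _ _).symm
    -- Congruence modulo I_σ suffices to compare pairings with p_i.
    have h3 := pairing_eq_of_toQuot_eq (h1.trans h2) (p i)
    rw [Matrix.of_apply, pairing_star, mul_comm (p i), ← mul_assoc, ← h3, Matrix.mul_apply,
      Finset.sum_mul, map_sum]
    refine Finset.sum_congr rfl fun m _ => ?_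
    rw [smul_mul_assoc, map_smul, mul_comm (q m), hpq, LinearMap.toMatrix_apply, hB, smul_eq_mul,
      mul_comm]
  rw [← key, Matrix.nonsing_inv_mul_cancel_left _ _ ((Matrix.isUnit_iff_isUnit_det _).1 hT)]

end MultiHankel

end

open MultiHankel in
theorem mainTheorem2 {n r' r d₁ d₂ : ℕ}
    (ω : Fin r' → MvPolynomial (Fin n) ℂ) (ξ : Fin r' → Fin n → ℂ)
    (σ : MvPowerSeries (Fin n) ℂ) (hσ : σ = MultiHankel.polyExp ω ξ)
    (hμ : ∑ i, MultiHankel.mu (ω i) = r)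
    (hrank : (MultiHankel.hankel σ d₁ d₂).rank = r)
    (U : Matrix (MultiHankel.Mon n d₁) (Fin (Fintype.card (MultiHankel.Mon n d₁))) ℂ)
    (S : Matrix (Fin (Fintype.card (MultiHankel.Mon n d₁)))
      (Fin (Fintype.card (MultiHankel.Mon n d₂))) ℂ)
    (V : Matrix (MultiHankel.Mon n d₂) (Fin (Fintype.card (MultiHankel.Mon n d₂))) ℂ)
    (hSVD : MultiHankel.IsSVD (MultiHankel.hankel σ d₁ d₂) U S V)
    (Ur : Matrix (Fin r) (MultiHankel.Mon n d₁) ℂ)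
    (hUr : Ur = (MultiHankel.firstCols (MultiHankel.le_card_rows hrank) U)ᴴ)
    (Sr : Matrix (Fin r) (Fin r) ℂ)
    (hSr : Sr = MultiHankel.leadingBlock (MultiHankel.le_card_rows hrank)
      (MultiHankel.le_card_cols hrank) S)
    (Vr : Matrix (MultiHankel.Mon n d₂) (Fin r) ℂ)
    (hVr : Vr = (MultiHankel.firstCols (MultiHankel.le_card_cols hrank) V).map (starRingEnd ℂ)) :
    ∃ BU BV : Module.Basis (Fin r) ℂ (MultiHankel.QuotAlg σ),
      (∀ i, BU i = MultiHankel.toQuot σ (MultiHankel.toPoly fun α => Ur i α)) ∧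
      (∀ j, BV j = MultiHankel.toQuot σ (MultiHankel.toPoly fun β => Vr β j)) ∧
      IsUnit Sr ∧
      ∀ i : Fin n, LinearMap.toMatrix BV BV (MultiHankel.mulOp σ (MvPolynomial.X i)) =
        Sr⁻¹ * Ur * MultiHankel.hankel (MultiHankel.star (MvPolynomial.X i) σ) d₁ d₂ * Vr := by
  subst hσ
  have hS : Ur * hankel (polyExp ω ξ) d₁ d₂ * Vr = Sr := by
    rw [hUr, hVr, hSr, hSVD.truncation_mul]
  have hSu : IsUnit Sr := hSr ▸ hSVD.isUnit_leadingBlock hrank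
  have hpair : ∀ i j, pairing (polyExp ω ξ) (toPoly (Ur i) * toPoly fun β => Vr β j) = Sr i j :=
    fun i j => by rw [pairing_rows_cols, hS]
  have hof : (Matrix.of fun i j =>
      pairing (polyExp ω ξ) (toPoly (Ur i) * toPoly fun β => Vr β j)) = Sr :=
    Matrix.ext hpair
  have hU := linearIndependent_toQuot (polyExp ω ξ) (hof.symm ▸ hSu)
  have hV : LinearIndependent ℂ fun j => toQuot (polyExp ω ξ) (toPoly fun β => Vr β j) := by
    -- With the roles of u and v exchanged, the pairing matrix is transposed.
    refine linearIndependent_toQuot (polyExp ω ξ) (q := fun i => toPoly (Ur i)) ?_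
    have ht : (Matrix.of fun j i =>
        pairing (polyExp ω ξ) ((toPoly fun β => Vr β j) * toPoly (Ur i))) = Srᵀ :=
      Matrix.ext fun j i => by rw [Matrix.of_apply, mul_comm, hpair, Matrix.transpose_apply]
    rw [ht]
    exact (Matrix.isUnit_transpose Sr).2 hSu
  have := finiteDimensional_quotAlg_polyExp ω ξ
  have hcard : Fintype.card (Fin r) = Module.finrank ℂ (QuotAlg (polyExp ω ξ)) :=
    le_antisymm hU.fintype_card_le_finrank (by
      rw [Fintype.card_fin, ← hμ]
      exact finrank_quotAlg_polyExp_le ω ξ)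
  refine ⟨basisOfLinearIndependentOfCardEqFinrank' _ hU hcard,
    basisOfLinearIndependentOfCardEqFinrank' _ hV hcard, fun i => by simp, fun j => by simp, hSu,
    fun i => ?_⟩
  rw [toMatrix_mulOp_eq (polyExp ω ξ) hSu hpair _ (fun j => by simp), Matrix.mul_assoc,
    Matrix.mul_assoc, ← Matrix.mul_assoc Ur]
  congr 1
  exact Matrix.ext fun l m => pairing_rows_cols _ Ur Vr l m
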